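/- Let $(M,g)$ be a smooth spacetime, that is, a connected, Hausdorff, second countable, finite-dimensional smooth manifold $M$ with a smooth Lorentzian metric $g$ of signature $(+,-,\dots,-)$ and a time orientation (given by a continuous timelike vector field $T$). A tangent vector $v \neq 0$ is timelike if $g(v,v)>0$ and causal if $g(v,v)\ge 0$; a causal vector is future-directed if $g(T,v)>0$. A future-directed timelike (causal) curve is a piecewise $C^1$ curve $\gamma:[a,b]\to M$, $a<b$, all of whose (one-sided) velocities are future-directed timelike (causal). Write $x\ll y$ if there is a future-directed timelike curve from $x$ to $y$, and $x\le y$ if $x=y$ or there is a future-directed causal curve from $x$ to $y$. Assume that the causal relation $\{(x,y)\in M^2 : x\le y\}$ is closed in $M^2$. Then the following are equivalent: 1. $(M,g)$ is globally hyperbolic, i.e. there is no closed causal curve, and for all $x,y\in M$ the causal diamond $J(x,y)=\{z\in M : x\le z\le y\}$ is compact. 2. $(M,g)$ is chronologically forward complete: every sequence $(x_n)$ in $M$ for which there is $z\in M$ with $x_n\ll x_{n+1}\ll z$ for all $n$ converges in $M$. 3. $(M,g)$ is chronologically backward complete, i.e. chronologically forward complete with respect to the opposite time orientation. 4. $(M,g)$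 is causally forward complete: every sequence $(x_n)$ in $M$ for which there is $z\in M$ with $x_n\le x_{n+1}\le z$ for all $n$ converges in $M$. 5. $(M,g)$ is causally backward complete, i.e. causally forward complete with respect to the opposite time orientation. -/

import Mathlib

open Set Filter Topology Manifold Bundle
open scoped ContDiff

/-- A symmetric bilinear form `B` has Lorentzian signature `(+,-,…,-)`: there is a vector `u` with
`B u u > 0` whose `B`-orthogonal complement is negative definite. -/
def IsLorentzForm {V : Type*} [AddCommGroup V] [Module ℝ V] [TopologicalSpace V]
    (B : V →L[ℝ] V →L[ℝ] ℝ) : Prop :=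
  (∀ v w, B v w = B w v) ∧
    ∃ u, 0 < B u u ∧ ∀ v, B u v = 0 → v ≠ 0 → B v v < 0

/-- A smooth Lorentzian metric, of signature `(+,-,…,-)`, on an `n`-dimensional smooth manifold:
a smooth section of the bundle of bilinear forms on the tangent spaces. -/
structure LorentzMetric (n : ℕ) (M : Type*) [TopologicalSpace M]
    [ChartedSpace (EuclideanSpace ℝ (Fin n)) M] [IsManifold (𝓡 n) ∞ M] where
  /-- the bilinear form on the tangent space at `x` -/
  form (x : M) : TangentSpace (𝓡 n) x →L[ℝ] TangentSpace (𝓡 n) x →L[ℝ] ℝ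
  lorentz (x : M) : IsLorentzForm (form x)
  smooth : ContMDiff (𝓡 n)
    ((𝓡 n).prod 𝓘(ℝ, EuclideanSpace ℝ (Fin n) →L[ℝ] EuclideanSpace ℝ (Fin n) →L[ℝ] ℝ)) ∞
    (fun x ↦ TotalSpace.mk' (EuclideanSpace ℝ (Fin n) →L[ℝ] EuclideanSpace ℝ (Fin n) →L[ℝ] ℝ)
      (E := fun x : M ↦ TangentSpace (𝓡 n) x →L[ℝ] TangentSpace (𝓡 n) x →L[ℝ] ℝ) x (form x))

section Spacetime

variable {n : ℕ} {M : Type*} [TopologicalSpace M] [ChartedSpace (EuclideanSpace ℝ (Fin n)) M]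
  [IsManifold (𝓡 n) ∞ M]

/-- A time orientation of a Lorentzian metric, given by a continuous timelike vector field
(`ContMDiff … 0` is continuity as a map into the tangent bundle), which is declared to be
future-directed. -/
structure TimeOrientation (g : LorentzMetric n M) where
  field (x : M) : TangentSpace (𝓡 n) x
  timelike (x : M) : 0 < g.form x (field x) (field x)
  continuous_field : ContMDiff (𝓡 n) ((𝓡 n).prod 𝓘(ℝ, EuclideanSpace ℝ (Fin n))) 0
    (fun x ↦ TotalSpace.mk' (EuclideanSpace ℝ (Fin n))
      (E := fun x : M ↦ TangentSpace (𝓡 n) x) x (field x))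

namespace TimeOrientation

variable {g : LorentzMetric n M}

/-- The opposite time orientation. -/
noncomputable def reverse (τ : TimeOrientation g) : TimeOrientation g where
  field x := -τ.field x
  timelike x := by simpa using τ.timelike x
  continuous_field := τ.continuous_field.neg_section

/-- `v` is a future-directed timelike tangent vector at `x`. -/
def FutureTimelike (τ : TimeOrientation g) (x : M) (v : TangentSpace (𝓡 n) x) : Prop :=
  0 < g.form x v v ∧ 0 < g.form x (τ.field x) v

/-- `v` is a future-directed causal tangent vector at `x`
(nonzero, and timelike or lightlike). -/
def FutureCausal (τ : TimeOrientation g) (x : M) (v : TangentSpace (𝓡 n) x) : Prop :=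
  v ≠ 0 ∧ 0 ≤ g.form x v v ∧ 0 < g.form x (τ.field x) v

end TimeOrientation

/-- `γ` restricts to a piecewise `C¹` curve on `[a, b]`, `a < b`, all of whose velocity vectors
satisfy `P`. At the finitely many break points both one-sided velocities have to satisfy `P`. -/
def IsPiecewiseC1CurveWithVelocityIn (P : ∀ x : M, TangentSpace (𝓡 n) x → Prop)
    (γ : ℝ → M) (a b : ℝ) : Prop :=
  a < b ∧ ∃ (k : ℕ) (t : ℕ → ℝ), t 0 = a ∧ t k = b ∧ ∀ i < k, t i < t (i + 1) ∧
    ContMDiffOn 𝓘(ℝ, ℝ) (𝓡 n) 1 γ (Icc (t i) (t (i + 1))) ∧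
    ∀ s ∈ Icc (t i) (t (i + 1)),
      P (γ s) (mfderivWithin 𝓘(ℝ, ℝ) (𝓡 n) γ (Icc (t i) (t (i + 1))) s (1 : ℝ))

namespace TimeOrientation

variable {g : LorentzMetric n M} (τ : TimeOrientation g)

/-- `γ : [a, b] → M` is a future-directed timelike curve. -/
def IsTimelikeCurve (γ : ℝ → M) (a b : ℝ) : Prop :=
  IsPiecewiseC1CurveWithVelocityIn τ.FutureTimelike γ a b

/-- `γ : [a, b] → M` is a future-directed causal curve. -/
def IsCausalCurve (γ : ℝ → M) (a b : ℝ) : Prop :=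
  IsPiecewiseC1CurveWithVelocityIn τ.FutureCausal γ a b

/-- The chronological (timelike) relation `x ≪ y`. -/
def Chron (x y : M) : Prop :=
  ∃ (γ : ℝ → M) (a b : ℝ), τ.IsTimelikeCurve γ a b ∧ γ a = x ∧ γ b = y

/-- The causal relation `x ≤ y`. -/
def Causal (x y : M) : Prop :=
  x = y ∨ ∃ (γ : ℝ → M) (a b : ℝ), τ.IsCausalCurve γ a b ∧ γ a = x ∧ γ b = y

/-- The causal diamond `J(x, y) = {z | x ≤ z ≤ y}`. -/
def diamond (x y : M) : Set M := {z | τ.Causal x z ∧ τ.Causal z y}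

/-- The spacetime is causal: there are no closed causal curves. -/
def NoClosedCausalCurve : Prop :=
  ∀ (γ : ℝ → M) (a b : ℝ), τ.IsCausalCurve γ a b → γ a ≠ γ b

/-- Global hyperbolicity: causality and compactness of all causal diamonds. -/
def GloballyHyperbolic : Prop :=
  τ.NoClosedCausalCurve ∧ ∀ x y : M, IsCompact (τ.diamond x y)

/-- Every sequence `x₀ ≪ x₁ ≪ ⋯` with an upper bound `z` for `≪` converges. -/
def ChronForwardComplete : Prop :=
  ∀ (x : ℕ → M) (z : M), (∀ k, τ.Chron (x k) (x (k + 1)) ∧ τ.Chron (x (k + 1)) z) →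
    ∃ p, Tendsto x atTop (𝓝 p)

/-- Chronological forward completeness for the opposite time orientation. -/
def ChronBackwardComplete : Prop := τ.reverse.ChronForwardComplete

/-- Every sequence `x₀ ≤ x₁ ≤ ⋯` with an upper bound `z` for `≤` converges. -/
def CausalForwardComplete : Prop :=
  ∀ (x : ℕ → M) (z : M), (∀ k, τ.Causal (x k) (x (k + 1)) ∧ τ.Causal (x (k + 1)) z) →
    ∃ p, Tendsto x atTop (𝓝 p)

/-- Causal forward completeness for the opposite time orientation. -/
def CausalBackwardComplete : Prop := τ.reverse.CausalForwardComplete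

end TimeOrientation

end Spacetime

/-! Global hyperbolicity is invariant under time reversal, so it suffices to link it with the two
forward conditions. Compact diamonds give causal completeness: an increasing bounded sequence stays
in a compact diamond, closedness of `≤` makes any two cluster points comparable both ways, and
antisymmetry leaves a single cluster point.

Causal completeness gives global hyperbolicity by an order-theoretic argument
(`isCompact_interval_of_increasing_converge`). Suppose an ultrafilter on a diamond has no limit. Its
"lower limits" form a closed bounded set, and completeness with second countability yields a maximal
lower limit `p`. Most points of the ultrafilter avoid a compact neighbourhood of `p`, so causal
curves reaching them from near `p` cross its frontier. By compactness the crossings would produce a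
lower limit strictly above `p`.

Chronological completeness gives causal completeness by shadowing a causal sequence with a
chronological one. This needs open chronological futures (`Chron.eventually`) and the push-up
property `x ≪ y ≤ z → x ≪ z` (`Chron.trans_causal`), both proved in charts. -/

/-! ### Closed orders: completeness versus compactness of intervals. -/

section ClosedOrder

variable {X : Type*} [TopologicalSpace X] {r : X → X → Prop}

/-- For a closed relation `r`, countably many `r`-lower sets separate the pairs `(w, w')` with
`¬ r w' w`. -/
theorem exists_seq_lower_separating [SecondCountableTopology X]
    (hrefl : ∀ x, r x x) (htrans : ∀ x y z, r x y → r y z → r x z)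
    (hclosed : IsClosed {p : X × X | r p.1 p.2}) :
    ∃ D : ℕ → Set X, (∀ k w w', r w w' → w' ∈ D k → w ∈ D k) ∧
      ∀ w w', ¬ r w' w → ∃ k, w ∈ D k ∧ w' ∉ D k := by
  obtain ⟨B, hB⟩ := TopologicalSpace.exists_seq_basis X
  -- Down-closures of a countable basis: if `¬ r w' w`, closedness gives a basic neighbourhood of
  -- `w` with no point above `w'`.
  refine ⟨fun k ↦ {w | ∃ b ∈ B k, r w b}, fun k w w' hw ⟨b, hb, hwb⟩ ↦
    ⟨b, hb, htrans _ _ _ hw hwb⟩, fun w w' hww' ↦ ?_⟩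
  have hev : ∀ᶠ b in 𝓝 w, ¬ r w' b :=
    (Continuous.prodMk_right w').continuousAt.eventually (hclosed.isOpen_compl.mem_nhds hww')
  obtain ⟨_, ⟨k, rfl⟩, hwk, hk⟩ := hB.mem_nhds_iff.1 hev
  exact ⟨k, ⟨w, hwk, hrefl w⟩, fun ⟨b, hb, hw'b⟩ ↦ hk hb hw'b⟩

/-- If increasing bounded sequences of a closed order converge, then in every closed set `S` and
above every point of `S` there is a maximal element of `S`, provided that `S` is bounded. -/
theorem exists_maximal_of_increasing_converge [SecondCountableTopology X]
    (hrefl : ∀ x, r x x) (htrans : ∀ x y z, r x y → r y z → r x z)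
    (hantisymm : ∀ x y, r x y → r y x → x = y)
    (hclosed : IsClosed {p : X × X | r p.1 p.2})
    (hconv : ∀ (x : ℕ → X) (z : X), (∀ k, r (x k) (x (k + 1)) ∧ r (x (k + 1)) z) →
      ∃ p, Tendsto x atTop (𝓝 p))
    {S : Set X} (hS : IsClosed S) {x y : X} (hx : x ∈ S) (hy : ∀ w ∈ S, r w y) :
    ∃ p ∈ S, ∀ w ∈ S, r p w → w = p := by
  obtain ⟨D, hlower, hsep⟩ := exists_seq_lower_separating hrefl htrans hclosed
  -- Greedy choice replacing Zorn's lemma: at stage `k` the sequence leaves the lower set `D k` if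
  -- any point of `S` above the current one does.
  have hstep : ∀ (k : ℕ) (w : S), ∃ w' : S, r w w' ∧
      ((∃ u ∈ S, r w u ∧ u ∉ D k) → (w' : X) ∉ D k) := by
    intro k w
    by_cases h : ∃ u ∈ S, r w u ∧ u ∉ D k
    · obtain ⟨u, hu, hwu, huD⟩ := h
      exact ⟨⟨u, hu⟩, hwu, fun _ ↦ huD⟩
    · exact ⟨w, hrefl _, fun h' ↦ (h h').elim⟩
  choose F hF hFD using hstep
  let s : ℕ → S := fun k ↦ Nat.rec (motive := fun _ ↦ S) ⟨x, hx⟩ F k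
  have hs : ∀ k, s (k + 1) = F k (s k) := fun _ ↦ rfl
  have hmono : ∀ k : ℕ, r (s k) (s (k + 1)) := fun k ↦ by rw [hs]; exact hF k (s k)
  obtain ⟨p, hp⟩ := hconv (fun k ↦ s k) y fun k ↦ ⟨hmono k, hy _ (s (k + 1)).2⟩
  have hle : ∀ k : ℕ, r (s k) p := fun k ↦ by
    refine hclosed.mem_of_tendsto (tendsto_const_nhds.prodMk_nhds hp)
      (eventually_atTop.2 ⟨k, fun m hm ↦ ?_⟩)
    induction m, hm using Nat.le_induction with
    | base => exact hrefl _
    | succ m _ ih => exact htrans _ _ _ ih (hmono m)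
  refine ⟨p, hS.mem_of_tendsto hp (Eventually.of_forall fun k ↦ (s k).2), fun w hw hpw ↦ ?_⟩
  by_contra hne
  -- A point `w` strictly above the limit would have forced `s (k + 1)` out of `D k`, yet `s (k +
  -- 1)` lies below `p ∈ D k`.
  obtain ⟨k, hpk, hwk⟩ := hsep p w fun hwp ↦ hne (hantisymm _ _ hwp hpw)
  refine hFD k (s k) ⟨w, hw, htrans _ _ _ (hle k) hpw, hwk⟩ ?_
  rw [← hs]
  exact hlower k _ _ (hle (k + 1)) hpk

/-- If increasing bounded sequences of a closed order on a locally compact space converge and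
comparable points can be connected within the order, then all order intervals are compact. -/
theorem isCompact_interval_of_increasing_converge [SecondCountableTopology X] [T2Space X]
    [LocallyCompactSpace X]
    (hrefl : ∀ x, r x x) (htrans : ∀ x y z, r x y → r y z → r x z)
    (hantisymm : ∀ x y, r x y → r y x → x = y)
    (hclosed : IsClosed {p : X × X | r p.1 p.2})
    (hcross : ∀ (U : Set X) (x y : X), IsOpen U → x ∈ U → y ∉ U → r x y →
      ∃ u ∈ frontier U, r x u ∧ r u y)
    (hconv : ∀ (x : ℕ → X) (z : X), (∀ k, r (x k) (x (k + 1)) ∧ r (x (k + 1)) z) →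
      ∃ p, Tendsto x atTop (𝓝 p)) (x y : X) :
    IsCompact {z | r x z ∧ r z y} := by
  have hclosed_left : ∀ a, IsClosed {z | r a z} := fun a ↦
    hclosed.preimage (Continuous.prodMk_right a)
  have hclosed_right : ∀ a, IsClosed {z | r z a} := fun a ↦
    hclosed.preimage (Continuous.prodMk_left a)
  refine isCompact_iff_ultrafilter_le_nhds.2 fun f hf ↦ ?_
  suffices h : ∃ p, (f : Filter X) ≤ 𝓝 p by
    obtain ⟨p, hp⟩ := h
    exact ⟨p, ((hclosed_left x).inter (hclosed_right y)).mem_of_tendsto (tendsto_id'.2 hp)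
      (le_principal_iff.1 hf), hp⟩
  by_contra! hlim
  -- The lower limits of `f`: points approximated by points below `f`-most `z`.
  let S : Set X := {w | ∀ V ∈ 𝓝 w, ∀ᶠ z in (f : Filter X), ∃ w' ∈ V, r w' z}
  have hS : IsClosed S := by
    refine isOpen_compl_iff.1 (isOpen_iff_mem_nhds.2 fun w hw ↦ ?_)
    simp only [S, mem_compl_iff, mem_ofPred_eq, not_forall] at hw
    obtain ⟨V, hV, hVf⟩ := hw
    filter_upwards [eventually_mem_nhds_iff.2 hV] with w' hw' h
    exact hVf (h V hw')
  have hfx : ∀ᶠ z in (f : Filter X), r x z ∧ r z y := le_principal_iff.1 hf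
  have hxS : x ∈ S := fun V hV ↦ hfx.mono fun z hz ↦ ⟨x, mem_of_mem_nhds hV, hz.1⟩
  have hSy : ∀ w ∈ S, r w y := by
    intro w hw
    by_contra hwy
    obtain ⟨z, ⟨w', hw', hw'z⟩, hz⟩ :=
      ((hw _ ((hclosed_right y).isOpen_compl.mem_nhds hwy)).and hfx).exists
    exact hw' (htrans _ _ _ hw'z hz.2)
  obtain ⟨p, hpS, hpmax⟩ := exists_maximal_of_increasing_converge hrefl htrans hantisymm hclosed
    hconv hS hxS hSy
  obtain ⟨V, hV, hVf⟩ : ∃ V ∈ 𝓝 p, V ∉ (f : Filter X) := by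
    simpa only [Filter.le_def, not_forall, exists_prop] using hlim p
  obtain ⟨K, hK, hKV, hKc⟩ := local_compact_nhds hV
  have hfr : IsCompact (frontier (interior K)) :=
    hKc.of_isClosed_subset isClosed_frontier
      (frontier_subset_closure.trans (closure_minimal interior_subset hKc.isClosed))
  have hpK : p ∈ interior K := mem_interior_iff_mem_nhds.2 hK
  -- Checked locally at each frontier point `u` and glued by compactness. If `p ≤ u` fails, it fails
  -- nearby by closedness; otherwise maximality of `p` gives `u ∉ S`, and the ultrafilter turns this
  -- failure into an eventual one.
  have key : ∃ V' ∈ 𝓝 p, ∀ᶠ z in (f : Filter X), ∀ w ∈ V', ∀ u ∈ frontier (interior K),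
      ¬ (r w u ∧ r u z) := by
    refine hfr.induction_on (p := fun s ↦ ∃ V' ∈ 𝓝 p, ∀ᶠ z in (f : Filter X), ∀ w ∈ V', ∀ u ∈ s,
      ¬ (r w u ∧ r u z)) ?_ ?_ ?_ ?_
    · exact ⟨univ, univ_mem, by simp⟩
    · rintro s t hst ⟨V', hV', h⟩
      exact ⟨V', hV', h.mono fun z hz w hw u hu ↦ hz w hw u (hst hu)⟩
    · rintro s t ⟨V₁, hV₁, h₁⟩ ⟨V₂, hV₂, h₂⟩
      refine ⟨V₁ ∩ V₂, inter_mem hV₁ hV₂, ?_⟩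
      filter_upwards [h₁, h₂] with z hz₁ hz₂ w hw u hu
      exact hu.elim (hz₁ w hw.1 u) (hz₂ w hw.2 u)
    · intro u hu
      by_cases hpu : r p u
      · have hne : u ≠ p := by
          rintro rfl
          exact (disjoint_interior_frontier (s := interior K)).notMem_of_mem_left
            (by rwa [interior_interior]) hu
        have huS : u ∉ S := fun h ↦ hne (hpmax u h hpu)
        simp only [S, mem_ofPred_eq, not_forall] at huS
        obtain ⟨N, hN, hNf⟩ := huS
        refine ⟨N, mem_nhdsWithin_of_mem_nhds hN, univ, univ_mem, ?_⟩
        filter_upwards [Ultrafilter.eventually_not.2 hNf] with z hz w _ u' hu' h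
        exact hz ⟨u', hu', h.2⟩
      · obtain ⟨A, hA, N, hN, hAN⟩ := mem_nhds_prod_iff.1
          (hclosed.isOpen_compl.mem_nhds (show (p, u) ∈ _ from hpu))
        exact ⟨N, mem_nhdsWithin_of_mem_nhds hN, A, hA,
          Eventually.of_forall fun z w hw u' hu' h ↦ hAN (mk_mem_prod hw hu') h.1⟩
  obtain ⟨V', hV', hV'f⟩ := key
  -- Since `p ∈ S`, some `w` near `p` lies below a `z` outside `V`; connecting them crosses the
  -- frontier, against `key`.
  obtain ⟨z, ⟨w, ⟨hwV', hwK⟩, hwz⟩, hz, hzV⟩ :=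
    ((hpS _ (inter_mem hV' (isOpen_interior.mem_nhds hpK))).and
      (hV'f.and (Ultrafilter.eventually_not.2 hVf))).exists
  obtain ⟨u, hu, hwu, huz⟩ := hcross (interior K) w z isOpen_interior hwK
    (fun h ↦ hzV (hKV (interior_subset h))) hwz
  exact hz w hwV' u hu ⟨hwu, huz⟩

/-- In a space with a closed order all of whose intervals are compact, increasing bounded sequences
converge. -/
theorem increasing_converge_of_isCompact_interval
    (hrefl : ∀ x, r x x) (htrans : ∀ x y z, r x y → r y z → r x z)
    (hantisymm : ∀ x y, r x y → r y x → x = y)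
    (hclosed : IsClosed {p : X × X | r p.1 p.2})
    (hcompact : ∀ x y, IsCompact {z | r x z ∧ r z y})
    (x : ℕ → X) (z : X) (hx : ∀ k, r (x k) (x (k + 1)) ∧ r (x (k + 1)) z) :
    ∃ p, Tendsto x atTop (𝓝 p) := by
  have hmono : ∀ k m, k ≤ m → r (x k) (x m) := fun k m hkm ↦ by
    induction m, hkm using Nat.le_induction with
    | base => exact hrefl _
    | succ m _ ih => exact htrans _ _ _ ih (hx m).1
  have hmem : ∀ k, x k ∈ {w | r (x 0) w ∧ r w z} := fun k ↦
    ⟨hmono 0 k k.zero_le, htrans _ _ _ (hx k).1 (hx k).2⟩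
  -- Every `x k` lies below the cluster point `q` by closedness, hence so does the cluster point
  -- `p`.
  have hcluster_le : ∀ p q, MapClusterPt p atTop x → MapClusterPt q atTop x → r p q := by
    intro p q hp hq
    have hpge : ∀ k, r (x k) q := fun k ↦ by
      have hc : IsClosed {w | r (x k) w} := hclosed.preimage (Continuous.prodMk_right (x k))
      refine hc.mem_of_mapClusterPt hq (eventually_atTop.2 ⟨k, fun m hm ↦ hmono k m hm⟩)
    have hc : IsClosed {w | r w q} := hclosed.preimage (Continuous.prodMk_left q)
    exact hc.mem_of_mapClusterPt hp (Eventually.of_forall hpge)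
  obtain ⟨p, -, hp⟩ := (hcompact (x 0) z).exists_mapClusterPt (f := atTop) (u := x)
    (tendsto_principal.2 (Eventually.of_forall hmem))
  refine ⟨p, (hcompact (x 0) z).tendsto_nhds_of_unique_mapClusterPt
    (Eventually.of_forall hmem) fun q _ hq ↦ ?_⟩
  exact hantisymm _ _ (hcluster_le q p hq hp) (hcluster_le p q hp hq)

end ClosedOrder

/-! ### Piecewise `C¹` curves as chains of `C¹` curves. -/

section Segments

variable {n : ℕ} {M : Type*} [TopologicalSpace M] [ChartedSpace (EuclideanSpace ℝ (Fin n)) M]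

/-- `γ` restricts to a `C¹` curve on `[a, b]`, `a < b`, all of whose velocity vectors
satisfy `P`. -/
def IsC1CurveWithVelocityIn (P : ∀ x : M, TangentSpace (𝓡 n) x → Prop)
    (γ : ℝ → M) (a b : ℝ) : Prop :=
  a < b ∧ ContMDiffOn 𝓘(ℝ, ℝ) (𝓡 n) 1 γ (Icc a b) ∧
    ∀ s ∈ Icc a b, P (γ s) (mfderivWithin 𝓘(ℝ, ℝ) (𝓡 n) γ (Icc a b) s (1 : ℝ))

/-- `x` and `y` are joined by a `C¹` curve all of whose velocity vectors satisfy `P`. -/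
def JoinedByC1Curve (P : ∀ x : M, TangentSpace (𝓡 n) x → Prop) (x y : M) : Prop :=
  ∃ (γ : ℝ → M) (a b : ℝ), IsC1CurveWithVelocityIn P γ a b ∧ γ a = x ∧ γ b = y

/-- `x` and `y` are joined by a piecewise `C¹` curve all of whose velocity vectors satisfy `P`. -/
def JoinedByPiecewiseC1Curve (P : ∀ x : M, TangentSpace (𝓡 n) x → Prop) (x y : M) : Prop :=
  ∃ (γ : ℝ → M) (a b : ℝ), IsPiecewiseC1CurveWithVelocityIn P γ a b ∧ γ a = x ∧ γ b = y

variable {P P' : ∀ x : M, TangentSpace (𝓡 n) x → Prop}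

/-- All tangent spaces are definitionally the model space, so velocities over points that are only
propositionally equal can be compared there. -/
theorem velocityPredicate_congr {x y : M} {v : TangentSpace (𝓡 n) x} {w : TangentSpace (𝓡 n) y}
    (hxy : x = y) (hvw : (v : EuclideanSpace ℝ (Fin n)) = w) (h : P x v) : P y w := by
  subst hxy
  have : v = w := hvw
  exact this ▸ h

theorem uniqueMDiffWithinAt_Icc {a b s : ℝ} (hab : a < b) (hs : s ∈ Icc a b) :
    UniqueMDiffWithinAt 𝓘(ℝ, ℝ) (Icc a b) s :=
  uniqueMDiffWithinAt_iff_uniqueDiffWithinAt.2 (uniqueDiffOn_Icc hab s hs)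

/-- Affine reparametrization of `C¹` curves. -/
theorem IsC1CurveWithVelocityIn.comp_affine {γ γ' : ℝ → M} {a b c d r q : ℝ}
    (h : IsC1CurveWithVelocityIn P γ a b) (hcd : c < d)
    (hmaps : ∀ s ∈ Icc c d, r * s + q ∈ Icc a b)
    (heq : ∀ s ∈ Icc c d, γ' s = γ (r * s + q)) (hP : ∀ x v, P x v → P' x (r • v)) :
    IsC1CurveWithVelocityIn P' γ' c d := by
  obtain ⟨hab, hγ, hv⟩ := h
  have hσ : ContDiff ℝ 1 fun s : ℝ ↦ r * s + q := by fun_prop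
  refine ⟨hcd, (hγ.comp hσ.contMDiff.contMDiffOn hmaps).congr heq, fun s hs ↦ ?_⟩
  have hd : HasMFDerivWithinAt 𝓘(ℝ, ℝ) 𝓘(ℝ, ℝ) (fun s : ℝ ↦ r * s + q) (Icc c d) s
      (ContinuousLinearMap.toSpanSingleton ℝ r) := by
    refine HasFDerivWithinAt.hasMFDerivWithinAt ?_
    have : HasDerivAt (fun s : ℝ ↦ r * s + q) r s := by
      simpa using ((hasDerivAt_id s).const_mul r).add_const q
    exact this.hasFDerivAt.hasFDerivWithinAt
  have hγd := ((hγ _ (hmaps s hs)).mdifferentiableWithinAt one_ne_zero).hasMFDerivWithinAt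
  have hmaps' : Icc c d ⊆ (fun s : ℝ ↦ r * s + q) ⁻¹' Icc a b := hmaps
  have hcomp := (hγd.comp s hd hmaps').congr_mono heq (heq s hs) Subset.rfl
  refine velocityPredicate_congr (heq s hs).symm ?_ (hP _ _ (hv _ (hmaps s hs)))
  rw [hcomp.mfderivWithin (uniqueMDiffWithinAt_Icc hcd hs)]
  have : (ContinuousLinearMap.toSpanSingleton ℝ r : ℝ →L[ℝ] ℝ) 1 = r • (1 : ℝ) := by simp
  exact ((map_smul (mfderivWithin 𝓘(ℝ, ℝ) (𝓡 n) γ (Icc a b) (r * s + q)) r (1 : ℝ)).symm.trans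
    (congrArg (mfderivWithin 𝓘(ℝ, ℝ) (𝓡 n) γ (Icc a b) (r * s + q)) this.symm))

theorem IsC1CurveWithVelocityIn.mono {γ : ℝ → M} {a b c d : ℝ}
    (h : IsC1CurveWithVelocityIn P γ a b) (hcd : c < d) (hac : a ≤ c) (hdb : d ≤ b) :
    IsC1CurveWithVelocityIn P γ c d :=
  h.comp_affine (r := 1) (q := 0) hcd (fun s hs ↦ by
    simpa using ⟨hac.trans hs.1, hs.2.trans hdb⟩) (fun s _ ↦ by simp) (fun x v hv ↦ by simpa using hv)

theorem IsC1CurveWithVelocityIn.joined {γ : ℝ → M} {a b c d : ℝ}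
    (h : IsC1CurveWithVelocityIn P γ a b) (hcd : c < d) (hac : a ≤ c) (hdb : d ≤ b) :
    JoinedByC1Curve P (γ c) (γ d) :=
  ⟨γ, c, d, h.mono hcd hac hdb, rfl, rfl⟩

theorem JoinedByC1Curve.reverse {x y : M} (hP : ∀ x v, P x v → P' x (-v))
    (h : JoinedByC1Curve P x y) : JoinedByC1Curve P' y x := by
  obtain ⟨γ, a, b, h, rfl, rfl⟩ := h
  refine ⟨fun s ↦ γ (-s), -b, -a, h.comp_affine (r := -1) (q := 0) (neg_lt_neg h.1) (fun s hs ↦ ?_)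
    (fun s _ ↦ by simp) (fun x v hv ↦ by simpa using hP x v hv), by simp, by simp⟩
  constructor <;> linarith [hs.1, hs.2]

/-- A piecewise `C¹` curve is divided into `C¹` curves. -/
theorem IsPiecewiseC1CurveWithVelocityIn.exists_partition {γ : ℝ → M} {a b : ℝ}
    (h : IsPiecewiseC1CurveWithVelocityIn P γ a b) :
    ∃ (k : ℕ) (t : ℕ → ℝ), 0 < k ∧ t 0 = a ∧ t k = b ∧
      ∀ i < k, IsC1CurveWithVelocityIn P γ (t i) (t (i + 1)) := by
  obtain ⟨hab, k, t, h0, hk, h⟩ := h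
  refine ⟨k, t, Nat.pos_of_ne_zero ?_, h0, hk, h⟩
  rintro rfl
  exact hab.ne (h0.symm.trans hk)

theorem JoinedByC1Curve.joinedByPiecewiseC1Curve {x y : M} (h : JoinedByC1Curve P x y) :
    JoinedByPiecewiseC1Curve P x y := by
  obtain ⟨γ, a, b, h, hx, hy⟩ := h
  refine ⟨γ, a, b, ⟨h.1, 1, fun i ↦ if i = 0 then a else b, by simp, by simp, fun i hi ↦ ?_⟩, hx, hy⟩
  obtain rfl : i = 0 := by omega
  simpa only [if_true, zero_add, one_ne_zero, if_false] using! h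

/-- Concatenation of a piecewise `C¹` curve and a `C¹` curve. -/
theorem JoinedByPiecewiseC1Curve.tail {x y z : M} (h : JoinedByPiecewiseC1Curve P x y)
    (h' : JoinedByC1Curve P y z) : JoinedByPiecewiseC1Curve P x z := by
  obtain ⟨γ, a, b, hγ, rfl, rfl⟩ := h
  obtain ⟨δ, c, d, hδ, hc, rfl⟩ := h'
  obtain ⟨k, t, -, rfl, rfl, ht⟩ := hγ.exists_partition
  have hcd := hδ.1
  have hmono : ∀ i ≤ k, t i ≤ t k := fun i hi ↦ by
    induction hi using Nat.decreasingInduction with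
    | self => exact le_rfl
    | of_succ i hi ih => exact (ht i hi).1.le.trans ih
  refine ⟨fun s ↦ if s ≤ t k then γ s else δ (s + (c - t k)), t 0, t k + (d - c),
    ⟨by linarith [hγ.1], k + 1, fun i ↦ if i ≤ k then t i else t k + (d - c), by simp, by simp,
      fun i hi ↦ ?_⟩, by simp [hγ.1.le], ?_⟩
  swap
  · simp only [not_le.2 (show t k < t k + (d - c) by linarith), if_false]
    congr 1
    ring
  rcases (Nat.lt_succ_iff.1 hi).lt_or_eq with hik | rfl
  · simp only [hik.le, Nat.succ_le_of_lt hik, if_true]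
    refine (ht i hik).comp_affine (r := 1) (q := 0) (ht i hik).1 (by simp) (fun s hs ↦ ?_)
      (fun x v hv ↦ by simpa using hv)
    simp [hs.2.trans (hmono _ hik)]
  · simp only [le_refl, if_true, Nat.not_succ_le_self, if_false]
    refine hδ.comp_affine (r := 1) (q := c - t i) (by linarith) (fun s hs ↦ ?_) (fun s hs ↦ ?_)
      (fun x v hv ↦ by simpa using hv)
    · constructor <;> linarith [hs.1, hs.2]
    -- At the junction the conditional selects `γ`, which agrees with `δ` there by `hc`.
    · rcases hs.1.eq_or_lt with rfl | hlt
      · simp [hc]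
      · simp [hlt.not_ge]

/-- In this form transitivity is automatic, and reversal, frontier crossing and push-up reduce to
single `C¹` pieces. -/
theorem joinedByPiecewiseC1Curve_iff_transGen {x y : M} :
    JoinedByPiecewiseC1Curve P x y ↔ Relation.TransGen (JoinedByC1Curve P) x y := by
  constructor
  · rintro ⟨γ, a, b, h, rfl, rfl⟩
    obtain ⟨k, t, hk, rfl, rfl, ht⟩ := h.exists_partition
    have hstep : ∀ i < k, Relation.TransGen (JoinedByC1Curve P) (γ (t 0)) (γ (t (i + 1))) := by
      intro i
      induction i with
      | zero => exact fun hi ↦ .single ⟨γ, _, _, ht 0 hi, rfl, rfl⟩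
      | succ i ih => exact fun hi ↦ (ih (by omega)).tail ⟨γ, _, _, ht _ hi, rfl, rfl⟩
    simpa [Nat.sub_add_cancel hk] using hstep (k - 1) (by omega)
  · intro h
    induction h with
    | single h => exact h.joinedByPiecewiseC1Curve
    | tail _ h ih => exact ih.tail h

theorem transGen_joinedByC1Curve_reverse {x y : M} (hP : ∀ x v, P x v → P' x (-v))
    (h : Relation.TransGen (JoinedByC1Curve P) x y) :
    Relation.TransGen (JoinedByC1Curve P') y x := by
  induction h with
  | single h => exact .single (h.reverse hP)
  | tail _ h ih => exact .head (h.reverse hP) ih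

/-- A curve leaving an open set meets its frontier. -/
theorem IsC1CurveWithVelocityIn.exists_mem_frontier {γ : ℝ → M} {a b : ℝ}
    (h : IsC1CurveWithVelocityIn P γ a b) {U : Set M} (hU : IsOpen U) (ha : γ a ∈ U)
    (hb : γ b ∉ U) : ∃ s ∈ Icc a b, γ s ∈ frontier U := by
  have hpre : IsPreconnected (γ '' Icc a b) := isPreconnected_Icc.image _ h.2.1.continuousOn
  by_contra! hfr
  have hcover : γ '' Icc a b ⊆ U ∪ (closure U)ᶜ := by
    rintro _ ⟨s, hs, rfl⟩
    by_contra h'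
    simp only [mem_union, mem_compl_iff, not_or, not_not] at h'
    exact hfr s hs (hU.frontier_eq ▸ ⟨h'.2, h'.1⟩)
  have hbU : γ b ∉ closure U := fun hb' ↦
    hfr b (right_mem_Icc.2 h.1.le) (hU.frontier_eq ▸ ⟨hb', hb⟩)
  obtain ⟨y, -, hyU, hyU'⟩ := hpre U (closure U)ᶜ hU isClosed_closure.isOpen_compl hcover
    ⟨γ a, mem_image_of_mem _ (left_mem_Icc.2 h.1.le), ha⟩
    ⟨γ b, mem_image_of_mem _ (right_mem_Icc.2 h.1.le), hbU⟩
  exact hyU' (subset_closure hyU)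

end Segments

/-! ### Order properties of `≪` and `≤`. -/

namespace TimeOrientation

variable {n : ℕ} {M : Type*} [TopologicalSpace M] [ChartedSpace (EuclideanSpace ℝ (Fin n)) M]
  [IsManifold (𝓡 n) ∞ M] {g : LorentzMetric n M} (τ : TimeOrientation g)

theorem chron_iff_transGen {x y : M} :
    τ.Chron x y ↔ Relation.TransGen (JoinedByC1Curve τ.FutureTimelike) x y :=
  joinedByPiecewiseC1Curve_iff_transGen

theorem causal_iff_eq_or_transGen {x y : M} :
    τ.Causal x y ↔ x = y ∨ Relation.TransGen (JoinedByC1Curve τ.FutureCausal) x y :=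
  or_congr_right joinedByPiecewiseC1Curve_iff_transGen

theorem causal_iff_reflTransGen {x y : M} :
    τ.Causal x y ↔ Relation.ReflTransGen (JoinedByC1Curve τ.FutureCausal) x y := by
  rw [causal_iff_eq_or_transGen, Relation.reflTransGen_iff_eq_or_transGen, eq_comm]

variable {τ}

theorem Chron.trans {x y z : M} (h : τ.Chron x y) (h' : τ.Chron y z) : τ.Chron x z := by
  rw [chron_iff_transGen] at *
  exact h.trans h'

theorem Causal.refl (x : M) : τ.Causal x x := Or.inl rfl

theorem Causal.trans {x y z : M} (h : τ.Causal x y) (h' : τ.Causal y z) : τ.Causal x z := by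
  rw [causal_iff_reflTransGen] at *
  exact h.trans h'

theorem Causal.of_joined {x y : M} (h : JoinedByC1Curve τ.FutureCausal x y) : τ.Causal x y :=
  τ.causal_iff_reflTransGen.2 (.single h)

theorem Causal.of_curve {γ : ℝ → M} {a b c d : ℝ}
    (h : IsC1CurveWithVelocityIn τ.FutureCausal γ a b) (hcd : c ≤ d) (hac : a ≤ c) (hdb : d ≤ b) :
    τ.Causal (γ c) (γ d) := by
  rcases hcd.eq_or_lt with rfl | hcd
  · exact .refl _
  · exact .of_joined (h.joined hcd hac hdb)

theorem FutureTimelike.futureCausal {x : M} {v : TangentSpace (𝓡 n) x}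
    (h : τ.FutureTimelike x v) : τ.FutureCausal x v :=
  ⟨by rintro rfl; simpa using h.1, h.1.le, h.2⟩

theorem Chron.causal {x y : M} (h : τ.Chron x y) : τ.Causal x y := by
  rw [chron_iff_transGen] at h
  refine τ.causal_iff_eq_or_transGen.2 (Or.inr (Relation.TransGen.mono ?_ _ _ h))
  rintro x y ⟨γ, a, b, hγ, hx, hy⟩
  exact ⟨γ, a, b, ⟨hγ.1, hγ.2.1, fun s hs ↦ (hγ.2.2 s hs).futureCausal⟩, hx, hy⟩

theorem reverse_reverse : τ.reverse.reverse = τ := by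
  cases τ
  simp [reverse]

theorem FutureTimelike.neg {x : M} {v : TangentSpace (𝓡 n) x} (h : τ.FutureTimelike x v) :
    τ.reverse.FutureTimelike x (-v) := by
  simpa [FutureTimelike, reverse] using h

theorem FutureCausal.neg {x : M} {v : TangentSpace (𝓡 n) x} (h : τ.FutureCausal x v) :
    τ.reverse.FutureCausal x (-v) := by
  simpa [FutureCausal, reverse] using h

theorem Causal.reverse {x y : M} (h : τ.Causal x y) : τ.reverse.Causal y x := by
  rw [causal_iff_eq_or_transGen] at h ⊢
  exact h.imp Eq.symm (transGen_joinedByC1Curve_reverse fun _ _ ↦ FutureCausal.neg)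

variable (τ) in
theorem causal_reverse_iff {x y : M} : τ.reverse.Causal x y ↔ τ.Causal y x :=
  ⟨fun h ↦ reverse_reverse (τ := τ) ▸ h.reverse, Causal.reverse⟩

/-- Points related by `≤` can be connected within the order. -/
theorem Causal.exists_mem_frontier {x y : M} (h : τ.Causal x y) {U : Set M} (hU : IsOpen U)
    (hx : x ∈ U) (hy : y ∉ U) : ∃ u ∈ frontier U, τ.Causal x u ∧ τ.Causal u y := by
  rw [causal_iff_reflTransGen] at h
  -- Head induction finds the first `C¹` piece ending outside `U`.
  induction h using Relation.ReflTransGen.head_induction_on with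
  | refl => exact (hy hx).elim
  | @head x z hxz hzy ih =>
    by_cases hz : z ∈ U
    · obtain ⟨u, hu, hzu, huy⟩ := ih hz
      exact ⟨u, hu, (Causal.of_joined hxz).trans hzu, huy⟩
    · obtain ⟨γ, a, b, hγ, rfl, rfl⟩ := hxz
      obtain ⟨s, hs, hsU⟩ := hγ.exists_mem_frontier hU hx hz
      exact ⟨γ s, hsU, .of_curve hγ hs.1 le_rfl hs.2,
        (Causal.of_curve hγ hs.2 hs.1 le_rfl).trans (τ.causal_iff_reflTransGen.2 hzy)⟩

/-- Causality, i.e. the absence of closed causal curves, is antisymmetry of `≤`. -/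
theorem noClosedCausalCurve_iff_antisymm :
    τ.NoClosedCausalCurve ↔ ∀ x y, τ.Causal x y → τ.Causal y x → x = y := by
  constructor
  · intro h x y hxy hyx
    by_contra hne
    have hxy' := (τ.causal_iff_eq_or_transGen.1 hxy).resolve_left hne
    have hyx' := (τ.causal_iff_eq_or_transGen.1 hyx).resolve_left (Ne.symm hne)
    obtain ⟨γ, a, b, hγ, ha, hb⟩ := joinedByPiecewiseC1Curve_iff_transGen.2 (hxy'.trans hyx')
    exact h γ a b hγ (ha.trans hb.symm)
  · intro h γ a b hγ hab
    obtain ⟨k, t, hk, rfl, rfl, ht⟩ := hγ.exists_partition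
    have hle : ∀ i, 1 ≤ i → i ≤ k → τ.Causal (γ (t 1)) (γ (t i)) := fun i hi ↦ by
      induction i, hi using Nat.le_induction with
      | base => exact fun _ ↦ .refl _
      | succ i _ ih =>
        exact fun hi ↦ (ih (by omega)).trans (.of_joined ⟨γ, _, _, ht i hi, rfl, rfl⟩)
    -- On a closed curve every point of the first piece is both above and below `γ (t 0)`.
    -- Antisymmetry makes this piece constant, so its velocity vanishes, which causal vectors
    -- exclude.
    have hconst : ∀ s ∈ Icc (t 0) (t 1), γ s = γ (t 0) := fun s hs ↦
      h _ _ (((Causal.of_curve (ht 0 hk) hs.2 hs.1 le_rfl).trans (hle k hk le_rfl)).trans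
        (hab ▸ .refl _)) (.of_curve (ht 0 hk) hs.1 le_rfl hs.2)
    have h0 : t 0 ∈ Icc (t 0) (t 1) := left_mem_Icc.2 (ht 0 hk).1.le
    refine ((ht 0 hk).2.2 _ h0).1 ?_
    have hd : HasMFDerivWithinAt 𝓘(ℝ, ℝ) (𝓡 n) γ (Icc (t 0) (t 1)) (t 0) 0 :=
      (hasMFDerivWithinAt_const (γ (t 0)) (Icc (t 0) (t 1)) (t 0)).congr_mono hconst rfl Subset.rfl
    rw [hd.mfderivWithin (uniqueMDiffWithinAt_Icc (ht 0 hk).1 h0)]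
    rfl

end TimeOrientation

/-! ### Tangent vectors, the metric and curves in charts. -/

section Chart

variable {n : ℕ} {M : Type*} [TopologicalSpace M] [ChartedSpace (EuclideanSpace ℝ (Fin n)) M]
  [IsManifold (𝓡 n) ∞ M]

/-- The tangent vector with coordinates `w` at the point with coordinates `e`, in the chart
at `p`. -/
noncomputable def chartVector (p : M) (e w : EuclideanSpace ℝ (Fin n)) :
    TangentSpace (𝓡 n) ((extChartAt (𝓡 n) p).symm e) :=
  (trivializationAt (EuclideanSpace ℝ (Fin n)) (TangentSpace (𝓡 n)) p).symmL ℝ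
    ((extChartAt (𝓡 n) p).symm e) w

theorem chartVector_add (p : M) (e w w' : EuclideanSpace ℝ (Fin n)) :
    chartVector p e (w + w') = chartVector p e w + chartVector p e w' :=
  map_add _ _ _

theorem chartVector_smul (p : M) (e w : EuclideanSpace ℝ (Fin n)) (c : ℝ) :
    chartVector p e (c • w) = c • chartVector p e w :=
  map_smul _ _ _

theorem exists_chartVector_eq (p : M) {e : EuclideanSpace ℝ (Fin n)}
    (he : e ∈ (extChartAt (𝓡 n) p).target)
    (u : TangentSpace (𝓡 n) ((extChartAt (𝓡 n) p).symm e)) : ∃ w, chartVector p e w = u := by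
  refine ⟨(trivializationAt (EuclideanSpace ℝ (Fin n)) (TangentSpace (𝓡 n)) p).continuousLinearMapAt
    ℝ ((extChartAt (𝓡 n) p).symm e) u, Trivialization.symmL_continuousLinearMapAt _ ?_ u⟩
  simpa using (extChartAt (𝓡 n) p).map_target he

/-- The map is the inverse bundle trivialization composed with the inverse chart. Joint smoothness
in base point and components is what later makes the timelike cone open and the metric locally
Lipschitz. -/
theorem contMDiffOn_chartVector (p : M) :
    ContMDiffOn 𝓘(ℝ, EuclideanSpace ℝ (Fin n) × EuclideanSpace ℝ (Fin n)) (𝓡 n).tangent ∞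
      (fun q : EuclideanSpace ℝ (Fin n) × EuclideanSpace ℝ (Fin n) ↦
        TotalSpace.mk' (EuclideanSpace ℝ (Fin n)) (E := fun x : M ↦ TangentSpace (𝓡 n) x)
          ((extChartAt (𝓡 n) p).symm q.1) (chartVector p q.1 q.2))
      ((extChartAt (𝓡 n) p).target ×ˢ univ) := by
  have hsymm := (trivializationAt (EuclideanSpace ℝ (Fin n)) (TangentSpace (𝓡 n) (M := M)) p).contMDiffOn_symm
    (n := ∞) (IB := 𝓡 n)
  have hfst : ContMDiffOn 𝓘(ℝ, EuclideanSpace ℝ (Fin n) × EuclideanSpace ℝ (Fin n)) (𝓡 n) ∞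
      (fun q : EuclideanSpace ℝ (Fin n) × EuclideanSpace ℝ (Fin n) ↦
        (extChartAt (𝓡 n) p).symm q.1) ((extChartAt (𝓡 n) p).target ×ˢ univ) :=
    (contMDiffOn_extChartAt_symm p).comp contDiff_fst.contMDiff.contMDiffOn fun q hq ↦ hq.1
  have hpair := hfst.prodMk (contDiff_snd (𝕜 := ℝ) (n := ∞) (E := EuclideanSpace ℝ (Fin n))
    (F := EuclideanSpace ℝ (Fin n))).contMDiff.contMDiffOn
  have hmem : ∀ q ∈ (extChartAt (𝓡 n) p).target ×ˢ (univ : Set (EuclideanSpace ℝ (Fin n))),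
      (extChartAt (𝓡 n) p).symm q.1 ∈
        (trivializationAt (EuclideanSpace ℝ (Fin n)) (TangentSpace (𝓡 n) (M := M)) p).baseSet :=
    fun q hq ↦ by simpa using (extChartAt (𝓡 n) p).map_target hq.1
  refine (hsymm.comp hpair fun q hq ↦ ?_).congr fun q hq ↦ ?_
  · rw [mem_preimage, Trivialization.mem_target]
    exact hmem q hq
  · simp only [Function.comp_apply]
    rw [← Trivialization.mk_symm _ (hmem q hq), chartVector, Trivialization.symmL_apply _ (hmem q hq)]

/-- A curve in the chart at `p` with velocity `w` has the tangent vector with coordinates `w`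
as its velocity in the manifold. -/
theorem hasMFDerivWithinAt_extChartAt_symm_comp (p : M) {c : ℝ → EuclideanSpace ℝ (Fin n)}
    {s : Set ℝ} {t : ℝ} {w : EuclideanSpace ℝ (Fin n)} (hc : HasDerivWithinAt c w s t)
    (ht : c t ∈ (extChartAt (𝓡 n) p).target) :
    HasMFDerivWithinAt 𝓘(ℝ, ℝ) (𝓡 n) (fun t ↦ (extChartAt (𝓡 n) p).symm (c t)) s t
      (ContinuousLinearMap.toSpanSingleton ℝ (chartVector p (c t) w)) := by
  have hsrc : (extChartAt (𝓡 n) p).symm (c t) ∈ (chartAt (EuclideanSpace ℝ (Fin n)) p).source := by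
    simpa using (extChartAt (𝓡 n) p).map_target ht
  have hA := TangentBundle.symmL_trivializationAt (I := 𝓡 n) hsrc
  rw [(extChartAt (𝓡 n) p).right_inv ht] at hA
  have hd := (mdifferentiableWithinAt_extChartAt_symm (I := 𝓡 n) ht).hasMFDerivWithinAt
  have := hd.comp t hc.hasFDerivWithinAt.hasMFDerivWithinAt (fun x _ ↦ by simp)
  refine this.congr_mfderiv ?_
  rw [← hA]
  ext
  exact map_smul (Trivialization.symmL ℝ (trivializationAt (EuclideanSpace ℝ (Fin n))
    (TangentSpace (𝓡 n)) p) ((extChartAt (𝓡 n) p).symm (c t))) (1 : ℝ) w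

end Chart

section ChartForm

variable {n : ℕ} {M : Type*} [TopologicalSpace M] [ChartedSpace (EuclideanSpace ℝ (Fin n)) M]
  [IsManifold (𝓡 n) ∞ M]

local notation "𝔼" => EuclideanSpace ℝ (Fin n)

/-- Smooth sections of the bundle of bilinear forms give smooth functions. -/
theorem contDiffOn_bilinear_apply {F : Type*} [NormedAddCommGroup F] [NormedSpace ℝ F]
    {k : WithTop ℕ∞} {b : F → M} {s : Set F}
    {B : ∀ x : M, TangentSpace (𝓡 n) x →L[ℝ] TangentSpace (𝓡 n) x →L[ℝ] ℝ}
    {v w : ∀ q : F, TangentSpace (𝓡 n) (b q)}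
    (hB : ContMDiff (𝓡 n) ((𝓡 n).prod 𝓘(ℝ, 𝔼 →L[ℝ] 𝔼 →L[ℝ] ℝ)) k
      (fun x ↦ TotalSpace.mk' (𝔼 →L[ℝ] 𝔼 →L[ℝ] ℝ)
        (E := fun x : M ↦ TangentSpace (𝓡 n) x →L[ℝ] TangentSpace (𝓡 n) x →L[ℝ] ℝ) x (B x)))
    (hb : ContMDiffOn 𝓘(ℝ, F) (𝓡 n) k b s)
    (hv : ContMDiffOn 𝓘(ℝ, F) (𝓡 n).tangent k
      (fun q ↦ TotalSpace.mk' 𝔼 (E := fun x : M ↦ TangentSpace (𝓡 n) x) (b q) (v q)) s)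
    (hw : ContMDiffOn 𝓘(ℝ, F) (𝓡 n).tangent k
      (fun q ↦ TotalSpace.mk' 𝔼 (E := fun x : M ↦ TangentSpace (𝓡 n) x) (b q) (w q)) s) :
    ContDiffOn ℝ k (fun q ↦ B (b q) (v q) (w q)) s := by
  rw [← contMDiffOn_iff_contDiffOn]
  intro q hq
  have : ContMDiffWithinAt 𝓘(ℝ, F) ((𝓡 n).prod 𝓘(ℝ)) k
      (fun q ↦ TotalSpace.mk' ℝ (E := Bundle.Trivial M ℝ) (b q) (B (b q) (v q) (w q))) s q := by
    apply ContMDiffWithinAt.clm_bundle_apply₂ (F₁ := 𝔼) (F₂ := 𝔼)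
    · exact ContMDiffAt.comp_contMDiffWithinAt q hB.contMDiffAt (hb q hq)
    · exact hv q hq
    · exact hw q hq
  simp only [contMDiffWithinAt_totalSpace] at this
  exact this.2

theorem contMDiffOn_chartVector_comp (p : M) {F : Type*} [NormedAddCommGroup F] [NormedSpace ℝ F]
    {s : Set F} {e w : F → 𝔼} (he : ContDiff ℝ ∞ e) (hw : ContDiff ℝ ∞ w)
    (hs : MapsTo e s (extChartAt (𝓡 n) p).target) :
    ContMDiffOn 𝓘(ℝ, F) (𝓡 n).tangent ∞
      (fun q : F ↦ TotalSpace.mk' 𝔼 (E := fun x : M ↦ TangentSpace (𝓡 n) x)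
        ((extChartAt (𝓡 n) p).symm (e q)) (chartVector p (e q) (w q))) s :=
  (contMDiffOn_chartVector p).comp (he.prodMk hw).contMDiff.contMDiffOn fun _ hq ↦
    ⟨hs hq, mem_univ _⟩

/-- The metric in coordinates depends smoothly on the point and on both vectors. -/
theorem LorentzMetric.contDiffOn_form_chartVector (g : LorentzMetric n M) (p : M) :
    ContDiffOn ℝ ∞ (fun q : 𝔼 × 𝔼 × 𝔼 ↦ g.form ((extChartAt (𝓡 n) p).symm q.1)
      (chartVector p q.1 q.2.1) (chartVector p q.1 q.2.2))
      ((extChartAt (𝓡 n) p).target ×ˢ univ) :=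
  contDiffOn_bilinear_apply (k := ∞) g.smooth
    ((contMDiffOn_extChartAt_symm p).comp contDiff_fst.contMDiff.contMDiffOn fun _ hq ↦ hq.1)
    (contMDiffOn_chartVector_comp p contDiff_fst contDiff_snd.fst fun _ hq ↦ hq.1)
    (contMDiffOn_chartVector_comp p contDiff_fst contDiff_snd.snd fun _ hq ↦ hq.1)

theorem TimeOrientation.continuousOn_form_field_chartVector {g : LorentzMetric n M}
    (τ : TimeOrientation g) (p : M) :
    ContinuousOn (fun q : 𝔼 × 𝔼 ↦ g.form ((extChartAt (𝓡 n) p).symm q.1)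
      (τ.field ((extChartAt (𝓡 n) p).symm q.1)) (chartVector p q.1 q.2))
      ((extChartAt (𝓡 n) p).target ×ˢ univ) := by
  have hb : ContMDiffOn 𝓘(ℝ, 𝔼 × 𝔼) (𝓡 n) 0 (fun q : 𝔼 × 𝔼 ↦ (extChartAt (𝓡 n) p).symm q.1)
      ((extChartAt (𝓡 n) p).target ×ˢ univ) :=
    (contMDiffOn_extChartAt_symm p).comp contDiff_fst.contMDiff.contMDiffOn fun _ hq ↦ hq.1
  exact (contDiffOn_bilinear_apply (k := 0) (g.smooth.of_le (by simp)) hb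
    (τ.continuous_field.comp_contMDiffOn hb)
    ((contMDiffOn_chartVector p).of_le (by simp))).continuousOn

end ChartForm

section ChartCurves

variable {n : ℕ} {M : Type*} [TopologicalSpace M] [ChartedSpace (EuclideanSpace ℝ (Fin n)) M]
  [IsManifold (𝓡 n) ∞ M] {P : ∀ x : M, TangentSpace (𝓡 n) x → Prop}

local notation "𝔼" => EuclideanSpace ℝ (Fin n)

theorem joinedByC1Curve_of_chart (p : M) {c c' : ℝ → 𝔼} {a b : ℝ} (hab : a < b)
    (hc : ContDiffOn ℝ 1 c (Icc a b)) (hc' : ∀ s ∈ Icc a b, HasDerivWithinAt c (c' s) (Icc a b) s)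
    (htarget : ∀ s ∈ Icc a b, c s ∈ (extChartAt (𝓡 n) p).target)
    (hP : ∀ s ∈ Icc a b, P ((extChartAt (𝓡 n) p).symm (c s)) (chartVector p (c s) (c' s))) :
    JoinedByC1Curve P ((extChartAt (𝓡 n) p).symm (c a)) ((extChartAt (𝓡 n) p).symm (c b)) := by
  refine ⟨fun s ↦ (extChartAt (𝓡 n) p).symm (c s), a, b, ⟨hab, ?_, fun s hs ↦ ?_⟩, rfl, rfl⟩
  · exact (contMDiffOn_extChartAt_symm p).comp hc.contMDiffOn htarget
  · refine velocityPredicate_congr rfl ?_ (hP s hs)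
    rw [(hasMFDerivWithinAt_extChartAt_symm_comp p (hc' s hs) (htarget s hs)).mfderivWithin
      (uniqueMDiffWithinAt_Icc hab hs)]
    exact (one_smul ℝ _).symm

/-- A `C¹` curve, near a parameter and in the chart at its point there. -/
theorem IsC1CurveWithVelocityIn.exists_chart {γ : ℝ → M} {a b : ℝ}
    (h : IsC1CurveWithVelocityIn P γ a b) {s₀ : ℝ} (hs₀ : s₀ ∈ Icc a b) :
    ∃ r > 0, ∃ c' : ℝ → 𝔼,
      (∀ s ∈ Icc a b ∩ Metric.ball s₀ r, γ s ∈ (extChartAt (𝓡 n) (γ s₀)).source) ∧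
      ContDiffOn ℝ 1 (fun s ↦ extChartAt (𝓡 n) (γ s₀) (γ s)) (Icc a b ∩ Metric.ball s₀ r) ∧
      ContinuousOn c' (Icc a b ∩ Metric.ball s₀ r) ∧
      ∀ s ∈ Icc a b ∩ Metric.ball s₀ r,
        HasDerivWithinAt (fun s ↦ extChartAt (𝓡 n) (γ s₀) (γ s)) (c' s)
          (Icc a b ∩ Metric.ball s₀ r) s ∧
        P ((extChartAt (𝓡 n) (γ s₀)).symm (extChartAt (𝓡 n) (γ s₀) (γ s)))
          (chartVector (γ s₀) (extChartAt (𝓡 n) (γ s₀) (γ s)) (c' s)) := by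
  obtain ⟨hab, hγ, hv⟩ := h
  obtain ⟨r, hr, hsub⟩ := Metric.mem_nhdsWithin_iff.1
    ((hγ.continuousOn s₀ hs₀).preimage_mem_nhdsWithin (extChartAt_source_mem_nhds (I := 𝓡 n) (γ s₀)))
  set D := Icc a b ∩ Metric.ball s₀ r with hD
  have hsrc : ∀ s ∈ D, γ s ∈ (extChartAt (𝓡 n) (γ s₀)).source := fun s hs ↦ hsub ⟨hs.2, hs.1⟩
  have hDu : UniqueDiffOn ℝ D := (uniqueDiffOn_Icc hab).inter Metric.isOpen_ball
  have hc : ContDiffOn ℝ 1 (fun s ↦ extChartAt (𝓡 n) (γ s₀) (γ s)) D := by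
    rw [← contMDiffOn_iff_contDiffOn]
    exact (contMDiffOn_extChartAt (I := 𝓡 n) (x := γ s₀) (n := 1)).comp (hγ.mono inter_subset_left)
      fun s hs ↦ by simpa using hsrc s hs
  refine ⟨r, hr, derivWithin (fun s ↦ extChartAt (𝓡 n) (γ s₀) (γ s)) D, hsrc, hc,
    hc.continuousOn_derivWithin hDu le_rfl, fun s hs ↦ ?_⟩
  have hd := ((hc s hs).differentiableWithinAt one_ne_zero).hasDerivWithinAt
  refine ⟨hd, ?_⟩
  have hleft := (extChartAt (𝓡 n) (γ s₀)).left_inv (hsrc s hs)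
  have hmf := (hasMFDerivWithinAt_extChartAt_symm_comp (γ s₀) hd
    ((extChartAt (𝓡 n) (γ s₀)).map_source (hsrc s hs))).congr_mono
      (fun s hs ↦ ((extChartAt (𝓡 n) (γ s₀)).left_inv (hsrc s hs)).symm) hleft.symm Subset.rfl
  have hmf' := hmf.mfderivWithin (uniqueMDiffWithinAt_iff_uniqueDiffWithinAt.2 (hDu s hs))
  -- The ball is a neighbourhood of `s`, so cutting down to it preserves the derivative within `Icc
  -- a b`, one-sided at the endpoints.
  rw [hD, mfderivWithin_inter (Metric.isOpen_ball.mem_nhds hs.2)] at hmf'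
  refine velocityPredicate_congr hleft.symm ?_ (hv s hs.1)
  rw [hmf']
  exact one_smul ℝ _

end ChartCurves

/-! ### Openness of the timelike cone and of chronological futures. -/

namespace TimeOrientation

variable {n : ℕ} {M : Type*} [TopologicalSpace M] [ChartedSpace (EuclideanSpace ℝ (Fin n)) M]
  [IsManifold (𝓡 n) ∞ M] {g : LorentzMetric n M} (τ : TimeOrientation g)

local notation "𝔼" => EuclideanSpace ℝ (Fin n)

theorem futureTimelike_field (x : M) : τ.FutureTimelike x (τ.field x) :=
  ⟨τ.timelike x, τ.timelike x⟩

/-- The future-directed timelike vectors in coordinates. -/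
def chartCone (p : M) : Set (𝔼 × 𝔼) :=
  {q | q.1 ∈ (extChartAt (𝓡 n) p).target ∧
    τ.FutureTimelike ((extChartAt (𝓡 n) p).symm q.1) (chartVector p q.1 q.2)}

theorem isOpen_chartCone (p : M) : IsOpen (τ.chartCone p) := by
  have hT : IsOpen ((extChartAt (𝓡 n) p).target ×ˢ (univ : Set 𝔼)) :=
    (isOpen_extChartAt_target p).prod isOpen_univ
  have h1 : ContinuousOn (fun q : 𝔼 × 𝔼 ↦ g.form ((extChartAt (𝓡 n) p).symm q.1)
      (chartVector p q.1 q.2) (chartVector p q.1 q.2)) ((extChartAt (𝓡 n) p).target ×ˢ univ) :=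
    (g.contDiffOn_form_chartVector p).continuousOn.comp
      (f := fun q : 𝔼 × 𝔼 ↦ (q.1, q.2, q.2)) (by fun_prop) fun q hq ↦ ⟨hq.1, mem_univ _⟩
  have := (h1.isOpen_inter_preimage hT (isOpen_Ioi (a := 0))).inter
    ((τ.continuousOn_form_field_chartVector p).isOpen_inter_preimage hT (isOpen_Ioi (a := 0)))
  convert this using 1
  ext q
  constructor
  · exact fun h ↦ ⟨⟨⟨h.1, mem_univ _⟩, h.2.1⟩, ⟨⟨h.1, mem_univ _⟩, h.2.2⟩⟩
  · exact fun h ↦ ⟨h.1.1.1, h.1.2, h.2.2⟩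

/-- Straight segments in a chart with timelike directions are timelike curves. -/
theorem joinedByC1Curve_of_segment {p : M} {U : Set 𝔼} (hU : Convex ℝ U) {e w : 𝔼} {δ : ℝ} (hδ : 0 < δ)
    (he : e ∈ U) (he' : e + δ • w ∈ U) (hw : ∀ x ∈ U, (x, w) ∈ τ.chartCone p) :
    JoinedByC1Curve τ.FutureTimelike ((extChartAt (𝓡 n) p).symm e)
      ((extChartAt (𝓡 n) p).symm (e + δ • w)) := by
  have hmem : ∀ s ∈ Icc 0 δ, e + s • w ∈ U := fun s hs ↦ by
    have := hU.add_smul_mem he he' (t := s / δ)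
      ⟨div_nonneg hs.1 hδ.le, div_le_one_of_le₀ hs.2 hδ.le⟩
    rwa [smul_smul, div_mul_cancel₀ _ hδ.ne'] at this
  have h := joinedByC1Curve_of_chart (P := τ.FutureTimelike) p (c := fun s ↦ e + s • w)
    (c' := fun _ ↦ w) hδ (by fun_prop) (fun s _ ↦ ?_) (fun s hs ↦ (hw _ (hmem s hs)).1)
    (fun s hs ↦ (hw _ (hmem s hs)).2)
  · simpa using h
  · simpa using (((hasDerivAt_id s).smul_const w).const_add e).hasDerivWithinAt

/-- Convex neighbourhoods on which given directions are timelike. -/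
theorem exists_ball_subset_chartCone {p : M} {e w : 𝔼} (h : (e, w) ∈ τ.chartCone p) :
    ∃ ρ > 0, ∀ x ∈ Metric.ball e ρ, ∀ w' ∈ Metric.ball w ρ, (x, w') ∈ τ.chartCone p := by
  obtain ⟨ρ, hρ, hsub⟩ := Metric.isOpen_iff.1 (τ.isOpen_chartCone p) _ h
  refine ⟨ρ, hρ, fun x hx w' hw' ↦ hsub ?_⟩
  rw [← ball_prod_same]
  exact ⟨hx, hw'⟩

/-- Every point is approximated by points in its chronological past. -/
theorem exists_chron_mem_nhds (y : M) {V : Set M} (hV : V ∈ 𝓝 y) : ∃ x ∈ V, τ.Chron x y := by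
  set φ := extChartAt (𝓡 n) y
  have hy : φ.symm (φ y) = y := extChartAt_to_inv y
  have hφy : φ y ∈ φ.target := mem_extChartAt_target y
  -- With `v` the coordinates of the time orientation at `y`, the segment from `φ y - δ • v` to `φ
  -- y` is timelike for small `δ`.
  obtain ⟨v, hv⟩ := exists_chartVector_eq y hφy (τ.field (φ.symm (φ y)))
  have hcone : (φ y, v) ∈ τ.chartCone y := ⟨hφy, by rw [hv]; exact τ.futureTimelike_field _⟩
  obtain ⟨ρ, hρ, hball⟩ := τ.exists_ball_subset_chartCone hcone
  have hcont : Tendsto (fun δ : ℝ ↦ φ y - δ • v) (𝓝[>] 0) (𝓝 (φ y)) := by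
    have : Continuous fun δ : ℝ ↦ φ y - δ • v := by fun_prop
    simpa using (this.tendsto 0).mono_left nhdsWithin_le_nhds
  have hsymm : Tendsto φ.symm (𝓝 (φ y)) (𝓝 (φ.symm (φ y))) :=
    continuousAt_extChartAt_symm y
  rw [hy] at hsymm
  obtain ⟨δ, hδV, hδρ, hδ⟩ := ((hsymm.comp hcont).eventually hV |>.and
    ((hcont.eventually (Metric.ball_mem_nhds _ hρ)).and self_mem_nhdsWithin)).exists
  refine ⟨_, hδV, τ.chron_iff_transGen.2 (.single ?_)⟩
  have := τ.joinedByC1Curve_of_segment (p := y) (convex_ball (φ y) ρ) (e := φ y - δ • v) (w := v) hδ hδρ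
    (by simpa using hρ) fun x hx ↦ hball x hx v (Metric.mem_ball_self hρ)
  simpa [φ, hy] using this

/-- The chronological future is open. -/
theorem Chron.eventually {τ : TimeOrientation g} {x y : M} (h : τ.Chron x y) :
    ∀ᶠ y' in 𝓝 y, τ.Chron x y' := by
  -- Only the last `C¹` piece is changed. Its chart slopes from `s` to `b` tend to the timelike
  -- velocity at `b`; for one `s` near `b`, the straight segment from `γ s` to any point close to `γ
  -- b` is therefore timelike.
  obtain ⟨z, hxz, γ, a, b, hγ, rfl, rfl⟩ := Relation.TransGen.tail'_iff.1 (τ.chron_iff_transGen.1 h)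
  have hbI : b ∈ Icc a b := right_mem_Icc.2 hγ.1.le
  obtain ⟨r, hr, c', hsrc, hc, -, hder⟩ := hγ.exists_chart hbI
  set φ := extChartAt (𝓡 n) (γ b)
  have hbD : b ∈ Icc a b ∩ Metric.ball b r := ⟨hbI, Metric.mem_ball_self hr⟩
  have hcone : (φ (γ b), c' b) ∈ τ.chartCone (γ b) :=
    ⟨φ.map_source (hsrc b hbD), (hder b hbD).2⟩
  obtain ⟨ρ, hρ, hball⟩ := τ.exists_ball_subset_chartCone hcone
  have hle : 𝓝[<] b ≤ 𝓝[(Icc a b ∩ Metric.ball b r) \ {b}] b := by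
    refine nhdsWithin_le_iff.2 ?_
    filter_upwards [Ioo_mem_nhdsLT hγ.1, mem_nhdsWithin_of_mem_nhds (Metric.ball_mem_nhds b hr)]
      with s hs hs'
    exact ⟨⟨⟨hs.1.le, hs.2.le⟩, hs'⟩, hs.2.ne⟩
  have hslope := (hasDerivWithinAt_iff_tendsto_slope.1 (hder b hbD).1).mono_left hle
  have hcs : Tendsto (fun s ↦ φ (γ s)) (𝓝[<] b) (𝓝 (φ (γ b))) :=
    (hc.continuousOn b hbD).tendsto.mono_left (hle.trans (nhdsWithin_mono _ sdiff_subset))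
  obtain ⟨s, ⟨hsρ, hsslope⟩, hsI, hsball⟩ :=
    (((hcs.eventually (Metric.ball_mem_nhds _ hρ)).and
      (hslope.eventually (Metric.ball_mem_nhds _ hρ))).and
      ((eventually_mem_set.2 (Ioo_mem_nhdsLT hγ.1)).and (eventually_mem_set.2
        (mem_nhdsWithin_of_mem_nhds (Metric.ball_mem_nhds b hr))))).exists
  have hsb : 0 < b - s := sub_pos.2 hsI.2
  have hxs : Relation.TransGen (JoinedByC1Curve τ.FutureTimelike) x (γ s) :=
    Relation.TransGen.tail'_iff.2 ⟨_, hxz, hγ.joined hsI.1 le_rfl hsI.2.le⟩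
  have hφc : ContinuousAt φ (γ b) := continuousAt_extChartAt _
  have hdir : ContinuousAt (fun y ↦ (b - s)⁻¹ • (φ y - φ (γ s))) (γ b) := by fun_prop
  have hdirb : (b - s)⁻¹ • (φ (γ b) - φ (γ s)) ∈ Metric.ball (c' b) ρ := by
    rw [slope_comm] at hsslope
    simpa [slope_def_module] using hsslope
  filter_upwards [hφc.eventually (Metric.ball_mem_nhds _ hρ),
    hdir.eventually (Metric.isOpen_ball.mem_nhds hdirb),
    extChartAt_source_mem_nhds (I := 𝓡 n) (γ b)] with y hyρ hydir hysrc
  refine τ.chron_iff_transGen.2 (hxs.tail ?_)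
  have heq : φ (γ s) + (b - s) • (b - s)⁻¹ • (φ y - φ (γ s)) = φ y := by
    rw [smul_inv_smul₀ hsb.ne', add_sub_cancel]
  have := τ.joinedByC1Curve_of_segment (p := γ b) (convex_ball (φ (γ b)) ρ) (e := φ (γ s))
    (w := (b - s)⁻¹ • (φ y - φ (γ s))) hsb hsρ (by rwa [heq]) fun x hx ↦ hball x hx _ hydir
  rw [heq] at this
  rwa [φ.left_inv hysrc, φ.left_inv (hsrc s ⟨⟨hsI.1.le, hsI.2.le⟩, hsball⟩)] at this

end TimeOrientation

/-! ### The push-up property. -/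

namespace TimeOrientation

variable {n : ℕ} {M : Type*} [TopologicalSpace M] [ChartedSpace (EuclideanSpace ℝ (Fin n)) M]
  [IsManifold (𝓡 n) ∞ M] {g : LorentzMetric n M} (τ : TimeOrientation g)

local notation "𝔼" => EuclideanSpace ℝ (Fin n)

/-- Adding `ε • v`, `v` timelike, to a causal vector makes it timelike, even if the base point is
moved by a small multiple of `ε • v`. -/
theorem exists_perturb_mem_chartCone {p : M} {e₀ w₀ v : 𝔼} (he₀ : e₀ ∈ (extChartAt (𝓡 n) p).target)
    (hv : chartVector p e₀ v = τ.field ((extChartAt (𝓡 n) p).symm e₀))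
    (hw₀ : 0 < g.form ((extChartAt (𝓡 n) p).symm e₀) (τ.field ((extChartAt (𝓡 n) p).symm e₀))
      (chartVector p e₀ w₀)) :
    ∃ η > 0, ∀ e ∈ Metric.ball e₀ η, ∀ w ∈ Metric.ball w₀ η, ∀ h ∈ Metric.ball (0 : ℝ) η,
      ∀ ε ∈ Metric.ball (0 : ℝ) η, 0 < ε →
      0 ≤ g.form ((extChartAt (𝓡 n) p).symm e) (chartVector p e w) (chartVector p e w) →
      (e - (ε * h) • v, w + ε • v) ∈ τ.chartCone p := by
  set φ := extChartAt (𝓡 n) p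
  set B : 𝔼 × 𝔼 × 𝔼 → ℝ := fun q ↦
    g.form (φ.symm q.1) (chartVector p q.1 q.2.1) (chartVector p q.1 q.2.2) with hB
  set Θ : 𝔼 × 𝔼 → ℝ := fun q ↦
    g.form (φ.symm q.1) (τ.field (φ.symm q.1)) (chartVector p q.1 q.2) with hΘ
  have htarget : IsOpen φ.target := isOpen_extChartAt_target p
  have hBd : ∀ w w' : 𝔼, ContDiffAt ℝ ∞ B (e₀, w, w') := fun w w' ↦
    (g.contDiffOn_form_chartVector p).contDiffAt
      ((htarget.prod isOpen_univ).mem_nhds ⟨he₀, mem_univ _⟩)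
  have hΘc : ∀ w : 𝔼, ContinuousAt Θ (e₀, w) := fun w ↦
    (τ.continuousOn_form_field_chartVector p).continuousAt
      ((htarget.prod isOpen_univ).mem_nhds ⟨he₀, mem_univ _⟩)
  have hsymm : ∀ w w' : 𝔼, B (e₀, w, w') = B (e₀, w', w) := fun w w' ↦
    (g.lorentz (φ.symm e₀)).1 _ _
  have hBvw : 0 < B (e₀, v, w₀) := by simp only [hB, hv]; exact hw₀
  have hBvv : 0 < B (e₀, v, v) := by simp only [hB, hv]; exact τ.timelike _
  have hΘv : 0 < Θ (e₀, v) := by simp only [hΘ, hv]; exact τ.timelike _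
  have hBd' : ContDiffAt ℝ 1 (fun q : 𝔼 × 𝔼 ↦ B (q.1, q.2, q.2)) (e₀, w₀) :=
    ((hBd w₀ w₀).of_le (by simp)).comp (e₀, w₀)
      (f := fun q : 𝔼 × 𝔼 ↦ (q.1, q.2, q.2)) (by fun_prop)
  -- Causality of `w` is known at `e` only; moving the base point by `(ε * h) • v` costs at most `K
  -- * ε * |h| * ‖v‖`, which for small `h` is dominated by the first-order gain in `ε`.
  obtain ⟨K, t, ht, hlip⟩ := hBd'.exists_lipschitzOnWith
  -- `q = (e, w, h, ε)`
  let X : 𝔼 × 𝔼 × ℝ × ℝ → 𝔼 := fun q ↦ q.1 - (q.2.2.2 * q.2.2.1) • v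
  have hX : Tendsto X (𝓝 (e₀, w₀, 0, 0)) (𝓝 e₀) := by
    have : Continuous X := by fun_prop
    simpa [X] using this.tendsto (e₀, w₀, 0, 0)
  have he : Tendsto (fun q : 𝔼 × 𝔼 × ℝ × ℝ ↦ q.1) (𝓝 (e₀, w₀, 0, 0)) (𝓝 e₀) :=
    continuous_fst.tendsto _
  have hw : Tendsto (fun q : 𝔼 × 𝔼 × ℝ × ℝ ↦ q.2.1) (𝓝 (e₀, w₀, 0, 0)) (𝓝 w₀) :=
    continuous_snd.fst.tendsto _
  have hh : Tendsto (fun q : 𝔼 × 𝔼 × ℝ × ℝ ↦ K * |q.2.2.1| * ‖v‖) (𝓝 (e₀, w₀, 0, 0)) (𝓝 0) := by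
    have : Continuous (fun q : 𝔼 × 𝔼 × ℝ × ℝ ↦ K * |q.2.2.1| * ‖v‖) := by fun_prop
    simpa using this.tendsto (e₀, w₀, 0, 0)
  have hev : ∀ᶠ q : 𝔼 × 𝔼 × ℝ × ℝ in 𝓝 (e₀, w₀, 0, 0),
      0 < q.2.2.2 → 0 ≤ B (q.1, q.2.1, q.2.1) →
        (X q, q.2.1 + q.2.2.2 • v) ∈ τ.chartCone p := by
    filter_upwards [hX.eventually (htarget.mem_nhds he₀),
      (he.prodMk_nhds hw).eventually ht, (hX.prodMk_nhds hw).eventually ht,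
      ((hBd v w₀).continuousAt.tendsto.comp
        (hX.prodMk_nhds (tendsto_const_nhds.prodMk_nhds hw))).eventually (lt_mem_nhds hBvw),
      ((hBd w₀ v).continuousAt.tendsto.comp
        (hX.prodMk_nhds (hw.prodMk_nhds tendsto_const_nhds))).eventually
          (lt_mem_nhds ((half_lt_self hBvw).trans_eq (hsymm v w₀))),
      ((hBd v v).continuousAt.tendsto.comp
        (hX.prodMk_nhds (tendsto_const_nhds.prodMk_nhds tendsto_const_nhds))).eventually
          (lt_mem_nhds hBvv),
      ((hΘc w₀).tendsto.comp (hX.prodMk_nhds hw)).eventually (lt_mem_nhds hw₀),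
      ((hΘc v).tendsto.comp (hX.prodMk_nhds tendsto_const_nhds)).eventually (lt_mem_nhds hΘv),
      hh.eventually (gt_mem_nhds (half_pos hBvw))]
      with ⟨e, w, h, ε⟩ hXt ht1 ht2 h1 h2 h3 h4 h5 h6 hε hcausal
    simp only [Function.comp_apply] at h1 h2 h3 h4 h5 h6 hε hcausal ⊢
    set x := X (e, w, h, ε)
    have hdist := hlip.dist_le_mul _ ht1 _ ht2
    have hxe : dist e x = ε * |h| * ‖v‖ := by
      simp [x, X, norm_smul, abs_of_pos hε]
    rw [Prod.dist_eq, dist_self, hxe, max_eq_left (by positivity), Real.dist_eq] at hdist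
    have hdist' := (abs_le.1 hdist).2
    refine ⟨hXt, ?_, ?_⟩
    · have hexp : g.form (φ.symm x) (chartVector p x (w + ε • v)) (chartVector p x (w + ε • v)) =
          B (x, w, w) + ε * (B (x, w, v) + B (x, v, w)) + ε * (ε * B (x, v, v)) := by
        simp only [hB, chartVector_add, chartVector_smul, map_add, map_smul,
          add_apply, smul_apply, smul_eq_mul]
        ring
      refine hexp ▸ ?_
      -- The loss is below `ε * B (e₀, v, w₀) / 2`, the term `ε * B (x, w, v)` exceeds that amount,
      -- and the other two terms are positive.
      have hε1 := mul_pos hε (sub_pos.2 h6)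
      have hε2 := mul_pos hε (sub_pos.2 h2)
      have hε3 := mul_pos hε h1
      have hε4 := mul_pos hε (mul_pos hε h3)
      linarith
    · simp only [chartVector_add, chartVector_smul, map_add, map_smul, smul_eq_mul]
      exact add_pos h4 (mul_pos hε h5)
  obtain ⟨η, hη, hsub⟩ := Metric.eventually_nhds_iff_ball.1 hev
  refine ⟨η, hη, fun e he w hw h hh ε hε hε0 hc ↦ hsub (e, w, h, ε) ?_ hε0 hc⟩
  simp only [← ball_prod_same]
  exact ⟨he, hw, hh, hε⟩

/-- Locally along a causal curve, the points in the chronological future of `x` remain so. -/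
theorem chron_of_causal_curve_local {γ : ℝ → M} {a b : ℝ}
    (hγ : IsC1CurveWithVelocityIn τ.FutureCausal γ a b) {s₀ : ℝ} (hs₀ : s₀ ∈ Icc a b) :
    ∃ δ > 0, ∀ s ∈ Icc a b ∩ Metric.ball s₀ δ, ∀ s' ∈ Icc a b ∩ Metric.ball s₀ δ, s ≤ s' →
      ∀ x, τ.Chron x (γ s) → τ.Chron x (γ s') := by
  obtain ⟨r, hr, c', hsrc, hc, hc'c, hder⟩ := hγ.exists_chart hs₀
  set φ := extChartAt (𝓡 n) (γ s₀)
  set D := Icc a b ∩ Metric.ball s₀ r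
  have hs₀D : s₀ ∈ D := ⟨hs₀, Metric.mem_ball_self hr⟩
  have htarget : ∀ s ∈ D, φ (γ s) ∈ φ.target := fun s hs ↦ φ.map_source (hsrc s hs)
  obtain ⟨v, hv⟩ := exists_chartVector_eq (γ s₀) (htarget s₀ hs₀D)
    (τ.field (φ.symm (φ (γ s₀))))
  obtain ⟨η, hη, hpert⟩ := τ.exists_perturb_mem_chartCone (htarget s₀ hs₀D) hv
    (hder s₀ hs₀D).2.2.2
  have hnear : ∀ᶠ s in 𝓝[D] s₀, φ (γ s) ∈ Metric.ball (φ (γ s₀)) η ∧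
      c' s ∈ Metric.ball (c' s₀) η :=
    ((hc.continuousOn s₀ hs₀D).eventually (Metric.ball_mem_nhds _ hη)).and
      ((hc'c s₀ hs₀D).eventually (Metric.ball_mem_nhds _ hη))
  obtain ⟨δ₁, hδ₁, hball⟩ := Metric.mem_nhdsWithin_iff.1 hnear
  -- Radius `η / 2` keeps any two parameters less than `η` apart, so that `h = s' - u` is admissible
  -- in `hpert`.
  have hδ : 0 < min δ₁ (min r (η / 2)) := by positivity
  refine ⟨_, hδ, fun s hs s' hs' hss' x hx ↦ ?_⟩
  rcases hss'.eq_or_lt with rfl | hlt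
  · exact hx
  have hsub : Icc s s' ⊆ Icc a b ∩ Metric.ball s₀ (min δ₁ (min r (η / 2))) := by
    rw [Real.ball_eq_Ioo] at hs hs' ⊢
    exact (ordConnected_Icc.inter ordConnected_Ioo).out hs hs'
  have hD : Icc s s' ⊆ D := fun u hu ↦ ⟨(hsub hu).1, Metric.ball_subset_ball (by simp) (hsub hu).2⟩
  have hnear' : ∀ u ∈ Icc s s', φ (γ u) ∈ Metric.ball (φ (γ s₀)) η ∧
      c' u ∈ Metric.ball (c' s₀) η := fun u hu ↦
    hball ⟨Metric.ball_subset_ball (by simp) (hsub hu).2, hD hu⟩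
  have hlen : s' - s < η := by
    have h1 := hs.2
    have h2 := hs'.2
    rw [Real.ball_eq_Ioo] at h1 h2
    have : min δ₁ (min r (η / 2)) ≤ η / 2 := (min_le_right _ _).trans (min_le_right _ _)
    linarith [h1.1, h2.2]
  -- The perturbed curve `u ↦ φ (γ u) - (ε * (s' - u)) • v` has velocity `c' u + ε • v` and still
  -- ends at `γ s'`. Its start tends to `γ s` as `ε → 0`, hence enters the open chronological future
  -- of `x`.
  have hstart : Tendsto (fun ε : ℝ ↦ φ.symm (φ (γ s) - (ε * (s' - s)) • v)) (𝓝[>] 0)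
      (𝓝 (γ s)) := by
    have h1 : Tendsto (fun ε : ℝ ↦ φ (γ s) - (ε * (s' - s)) • v) (𝓝[>] 0) (𝓝 (φ (γ s))) := by
      have : Continuous fun ε : ℝ ↦ φ (γ s) - (ε * (s' - s)) • v := by fun_prop
      simpa using (this.tendsto 0).mono_left nhdsWithin_le_nhds
    have hsD := hD (left_mem_Icc.2 hss')
    have h2 : Tendsto φ.symm (𝓝 (φ (γ s))) (𝓝 (φ.symm (φ (γ s)))) :=
      continuousAt_extChartAt_symm'' (htarget s hsD)
    rw [φ.left_inv (hsrc s hsD)] at h2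
    exact h2.comp h1
  obtain ⟨ε, hxε, hεη, hε⟩ := ((hstart.eventually hx.eventually).and
    ((eventually_mem_set.2 (mem_nhdsWithin_of_mem_nhds (Metric.ball_mem_nhds (0 : ℝ) hη))).and
      self_mem_nhdsWithin)).exists
  have hcone : ∀ u ∈ Icc s s', (φ (γ u) - (ε * (s' - u)) • v, c' u + ε • v) ∈
      τ.chartCone (γ s₀) := fun u hu ↦ by
    refine hpert _ (hnear' u hu).1 _ (hnear' u hu).2 _ ?_ ε hεη hε (hder u (hD hu)).2.2.1
    rw [mem_ball_zero_iff, Real.norm_eq_abs, abs_of_nonneg (by linarith [hu.2])]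
    linarith [hu.1]
  have hjoin := joinedByC1Curve_of_chart (P := τ.FutureTimelike) (γ s₀)
    (c := fun u ↦ φ (γ u) - (ε * (s' - u)) • v) (c' := fun u ↦ c' u + ε • v) hlt
    ((hc.mono hD).sub (by fun_prop)) (fun u hu ↦ ?_) (fun u hu ↦ (hcone u hu).1)
    (fun u hu ↦ (hcone u hu).2)
  · simp only [sub_self, mul_zero, zero_smul, sub_zero] at hjoin
    have hleft := φ.left_inv (hsrc s' (hD (right_mem_Icc.2 hss')))
    rw [hleft] at hjoin
    exact hxε.trans (τ.chron_iff_transGen.2 (.single hjoin))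
  · have h1 : HasDerivWithinAt (fun u ↦ (ε * (s' - u)) • v) ((ε * (-1)) • v) (Icc s s') u :=
      ((((hasDerivAt_id u).const_sub s').const_mul ε).smul_const v).hasDerivWithinAt
    rw [show c' u + ε • v = c' u - (ε * (-1)) • v by simp]
    exact ((hder u (hD hu)).1.mono hD).sub h1

/-- The push-up property for `C¹` curves. -/
theorem Chron.trans_causal_curve {τ : TimeOrientation g} {γ : ℝ → M} {a b : ℝ}
    (hγ : IsC1CurveWithVelocityIn τ.FutureCausal γ a b) {x : M} (hx : τ.Chron x (γ a)) :
    τ.Chron x (γ b) := by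
  choose δ hδ hstep using fun s₀ : Icc a b ↦ τ.chron_of_causal_curve_local hγ s₀.2
  -- Compactness of `[a, b]` subdivides it into finitely many intervals, each inside one ball where
  -- the local step applies.
  obtain ⟨t, ht0, hmono, ⟨m, hm⟩, hcover⟩ := exists_monotone_Icc_subset_open_cover_Icc hγ.1.le
    (c := fun s₀ : Icc a b ↦ Metric.ball s₀ (δ s₀)) (fun _ ↦ Metric.isOpen_ball)
    (fun s _ ↦ mem_iUnion.2 ⟨s, Metric.mem_ball_self (hδ s)⟩)
  have hall : ∀ k, τ.Chron x (γ (t k)) := by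
    intro k
    induction k with
    | zero => simpa [ht0] using hx
    | succ k ih =>
      obtain ⟨s₀, hs₀⟩ := hcover k
      have hk := hmono k.le_succ
      exact hstep s₀ (t k) ⟨(t k).2, hs₀ (left_mem_Icc.2 hk)⟩ (t (k + 1))
        ⟨(t (k + 1)).2, hs₀ (right_mem_Icc.2 hk)⟩ hk x ih
  simpa [hm m le_rfl] using hall m

/-- The push-up property. -/
theorem Chron.trans_causal {τ : TimeOrientation g} {x y z : M} (h : τ.Chron x y)
    (h' : τ.Causal y z) : τ.Chron x z := by
  rw [causal_iff_reflTransGen] at h'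
  induction h' with
  | refl => exact h
  | tail _ hbc ih =>
    obtain ⟨γ, a, b, hγ, rfl, rfl⟩ := hbc
    exact ih.trans_causal_curve hγ

end TimeOrientation

/-! ### The equivalences. -/

namespace TimeOrientation

variable {n : ℕ} {M : Type*} [TopologicalSpace M] [ChartedSpace (EuclideanSpace ℝ (Fin n)) M]
  [IsManifold (𝓡 n) ∞ M] {g : LorentzMetric n M} {τ : TimeOrientation g}

theorem CausalForwardComplete.chronForwardComplete (h : τ.CausalForwardComplete) :
    τ.ChronForwardComplete :=
  fun x z hx ↦ h x z fun k ↦ ⟨(hx k).1.causal, (hx k).2.causal⟩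

/-- A chronological sequence `y k ≪ x k` is built with distance to `x k` tending to zero in a
compatible metric; it is bounded by `z` through push-up, so it converges and `x` has the same limit.
-/
theorem ChronForwardComplete.causalForwardComplete [T2Space M] [SecondCountableTopology M]
    (h : τ.ChronForwardComplete) : τ.CausalForwardComplete := by
  intro x z hx
  have : LocallyCompactSpace M := ChartedSpace.locallyCompactSpace (EuclideanSpace ℝ (Fin n)) M
  let _ : MetricSpace M := TopologicalSpace.metrizableSpaceMetric M
  -- Push-up gives `w ≪ x (k + 1)`, openness extends this to a neighbourhood of `x (k + 1)`, and
  -- that neighbourhood meets the chronological past of `x (k + 1)`.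
  have hstep : ∀ (k : ℕ) (w : {w // τ.Chron w (x k)}), ∃ w' : {w // τ.Chron w (x (k + 1))},
      τ.Chron w w' ∧ dist (w' : M) (x (k + 1)) < 1 / ((k : ℝ) + 1) := by
    rintro k ⟨w, hw⟩
    obtain ⟨w', ⟨hww', hdist⟩, hw'⟩ := τ.exists_chron_mem_nhds (x (k + 1))
      (inter_mem (hw.trans_causal (hx k).1).eventually
        (Metric.ball_mem_nhds _ (Nat.one_div_pos_of_nat (α := ℝ) (n := k))))
    exact ⟨⟨w', hw'⟩, hww', hdist⟩
  choose F hFchron hFdist using hstep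
  obtain ⟨w₀, -, hw₀⟩ := τ.exists_chron_mem_nhds (x 0) univ_mem
  let y : ∀ k, {w // τ.Chron w (x k)} := fun k ↦
    Nat.rec (motive := fun k ↦ {w // τ.Chron w (x k)}) ⟨w₀, hw₀⟩ F k
  have hy : ∀ k, y (k + 1) = F k (y k) := fun _ ↦ rfl
  obtain ⟨p, hp⟩ := h (fun k ↦ y k) z fun k ↦
    ⟨by rw [hy]; exact hFchron k (y k), (y (k + 1)).2.trans_causal (hx k).2⟩
  -- The initial `y 0` is only required to precede `x 0`, so the distance bound starts at index `1`.
  refine ⟨p, (tendsto_add_atTop_iff_nat 1).1 ?_⟩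
  refine ((tendsto_add_atTop_iff_nat 1).2 hp).congr_dist ?_
  refine squeeze_zero (fun _ ↦ dist_nonneg) (fun k ↦ ?_) tendsto_one_div_add_atTop_nhds_zero_nat
  rw [hy]
  exact (hFdist k (y k)).le

/-- The alternating sequence `x, y, x, y, …` is increasing and bounded by `x`; its limit must equal
both points. -/
theorem CausalForwardComplete.antisymm [T2Space M] (h : τ.CausalForwardComplete) {x y : M}
    (hxy : τ.Causal x y) (hyx : τ.Causal y x) : x = y := by
  obtain ⟨p, hp⟩ := h (fun k ↦ if Even k then x else y) x fun k ↦ by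
    by_cases hk : Even k <;> simp [hk, Nat.even_add_one, hxy, hyx, Causal.refl]
  have heven : Tendsto (fun k : ℕ ↦ 2 * k) atTop atTop :=
    tendsto_id.const_mul_atTop' two_pos
  have hx : Tendsto (fun _ : ℕ ↦ x) atTop (𝓝 p) := by
    simpa [Function.comp_def] using hp.comp heven
  have hy : Tendsto (fun _ : ℕ ↦ y) atTop (𝓝 p) := by
    simpa [Function.comp_def, Nat.even_add_one] using
      hp.comp ((tendsto_add_atTop_nat 1).comp heven)
  exact (tendsto_nhds_unique tendsto_const_nhds hx).trans
    (tendsto_nhds_unique tendsto_const_nhds hy).symm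

theorem CausalForwardComplete.globallyHyperbolic [T2Space M] [SecondCountableTopology M]
    (hclosed : IsClosed {p : M × M | τ.Causal p.1 p.2}) (h : τ.CausalForwardComplete) :
    τ.GloballyHyperbolic := by
  have : LocallyCompactSpace M := ChartedSpace.locallyCompactSpace (EuclideanSpace ℝ (Fin n)) M
  exact ⟨noClosedCausalCurve_iff_antisymm.2 fun _ _ ↦ h.antisymm,
    isCompact_interval_of_increasing_converge Causal.refl (fun _ _ _ ↦ Causal.trans)
      (fun _ _ ↦ h.antisymm) hclosed (fun _ _ _ hU hx hy hxy ↦ hxy.exists_mem_frontier hU hx hy) h⟩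

theorem GloballyHyperbolic.causalForwardComplete
    (hclosed : IsClosed {p : M × M | τ.Causal p.1 p.2}) (h : τ.GloballyHyperbolic) :
    τ.CausalForwardComplete :=
  increasing_converge_of_isCompact_interval Causal.refl (fun _ _ _ ↦ Causal.trans)
    (noClosedCausalCurve_iff_antisymm.1 h.1) hclosed h.2

theorem isClosed_causal_reverse (hclosed : IsClosed {p : M × M | τ.Causal p.1 p.2}) :
    IsClosed {p : M × M | τ.reverse.Causal p.1 p.2} := by
  simp only [causal_reverse_iff]
  exact hclosed.preimage continuous_swap

/-- Reversal exchanges the endpoints of diamonds and leaves antisymmetry unchanged; this carries the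
forward results over to the backward conditions. -/
theorem globallyHyperbolic_reverse_iff : τ.reverse.GloballyHyperbolic ↔ τ.GloballyHyperbolic := by
  simp only [GloballyHyperbolic, noClosedCausalCurve_iff_antisymm, diamond, causal_reverse_iff]
  refine and_congr ⟨fun h x y hxy hyx ↦ h x y hyx hxy, fun h x y hxy hyx ↦ h x y hyx hxy⟩ ?_
  rw [forall_comm]
  simp only [and_comm]

end TimeOrientation

theorem mainTheorem10 {n : ℕ} {M : Type*} [TopologicalSpace M]
    [ChartedSpace (EuclideanSpace ℝ (Fin n)) M] [IsManifold (𝓡 n) ∞ M]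
    [T2Space M] [SecondCountableTopology M] [ConnectedSpace M]
    (g : LorentzMetric n M) (τ : TimeOrientation g)
    (hclosed : IsClosed {p : M × M | τ.Causal p.1 p.2}) :
    List.TFAE [
      τ.GloballyHyperbolic,
      τ.ChronForwardComplete,
      τ.ChronBackwardComplete,
      τ.CausalForwardComplete,
      τ.CausalBackwardComplete] := by
  have hclosed' := TimeOrientation.isClosed_causal_reverse hclosed
  tfae_have 1 → 4 := fun h ↦ h.causalForwardComplete hclosed
  tfae_have 4 → 2 := fun h ↦ h.chronForwardComplete
  tfae_have 2 → 1 := fun h ↦ h.causalForwardComplete.globallyHyperbolic hclosed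
  tfae_have 1 → 5 := fun h ↦
    (TimeOrientation.globallyHyperbolic_reverse_iff.2 h).causalForwardComplete hclosed'
  tfae_have 5 → 3 := fun h ↦ TimeOrientation.CausalForwardComplete.chronForwardComplete h
  tfae_have 3 → 1 := fun h ↦ TimeOrientation.globallyHyperbolic_reverse_iff.1
    ((TimeOrientation.ChronForwardComplete.causalForwardComplete h).globallyHyperbolic hclosed')
  tfae_finish
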